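/- A \emph{Deutsch path} of length $n$ ending at level $i$ is a sequence $(c_0,c_1,\dots,c_n)$ of nonnegative integers with $c_0=0$, $c_n=i$ and $c_{j}-c_{j-1}\in\{1,-1,-3,-5,\dots\}$ for $1\le j\le n$; a \emph{reversed Deutsch path} of length $n$ ending at level $i$ is such a sequence with $c_0=0$, $c_n=i$ and $c_j-c_{j-1}\in\{-1,1,3,5,\dots\}$ for $1\le j\le n$. Let $f_i(z)$ (respectively $g_i(z)$) be the formal power series whose coefficient of $z^n$ is the number of Deutsch paths (respectively reversed Deutsch paths) of length $n$ ending at level $i$. The area of a path is the sum $c_0+\dots+c_n$ of its ordinates. Let $A_m$ be the sum of the areas of all Deutsch paths of length $m$ ending at level $0$, and put $\mathrm{AREA}(z)=\sum_{m\ge0}A_mz^m$. There is a unique formal power series $t=t(z)\in\mathbb{Q}[[z]]$ with zero constant term and $z^2=t(1-t)^2$, and with this $t$ $$\mathrm{AREA}(z)=\sum_{i\ge0} i\,f_i(z)\,g_i(z)=\frac{t(1+3t)}{(1-t)(1-3t)^2},$$ where only finitely many terms of the sum contribute to any given power of $z$. Moreover, for every $n\ge0$, $$A_{2n}=[z^{2n}]\,\mathrm{AREA}(z)=\sum_{k\ge0}3^k\left[\binom{3n-k}{n-1-k}+3\binom{3n-1-k}{n-2-k}\right],$$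 where a binomial coefficient with negative lower entry is $0$ (so the sum is finite). -/

import Mathlib

open scoped PowerSeries

/-- A step of a Deutsch path from ordinate `a` to ordinate `b`:
an up-step `+1`, or a down-step `-1, -3, -5, …`. -/
def IsDeutschStep (a b : ℕ) : Prop :=
  b = a + 1 ∨ ∃ j : ℕ, a = b + (2 * j + 1)

/-- A step of a reversed Deutsch path from ordinate `a` to ordinate `b`:
a down-step `-1`, or an up-step `+1, +3, +5, …`. -/
def IsReversedDeutschStep (a b : ℕ) : Prop :=
  a = b + 1 ∨ ∃ j : ℕ, b = a + (2 * j + 1)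

/-- Deutsch paths of length `n` ending at level `i`, given by their sequences
`c 0 = 0, c 1, …, c n = i` of (nonnegative) ordinates. -/
def deutschPaths (n i : ℕ) : Set (Fin (n + 1) → ℕ) :=
  {c | c 0 = 0 ∧ c (Fin.last n) = i ∧ ∀ j : Fin n, IsDeutschStep (c j.castSucc) (c j.succ)}

/-- Reversed Deutsch paths (Deutsch paths read from right to left) of length `n`
starting at level `0` and ending at level `i`. -/
def reversedDeutschPaths (n i : ℕ) : Set (Fin (n + 1) → ℕ) :=
  {c | c 0 = 0 ∧ c (Fin.last n) = i ∧
    ∀ j : Fin n, IsReversedDeutschStep (c j.castSucc) (c j.succ)}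

theorem deutschPaths_finite (n i : ℕ) : (deutschPaths n i).Finite := by
  refine (Set.finite_Iic (fun _ : Fin (n + 1) => n)).subset ?_
  rintro c ⟨h0, -, hs⟩
  have key : ∀ j : Fin (n + 1), c j ≤ j := by
    intro j
    induction j using Fin.induction with
    | zero => simp [h0]
    | succ j ih =>
      simp only [Fin.val_castSucc, Fin.val_succ] at ih ⊢
      rcases hs j with h | ⟨k, h⟩ <;> omega
  intro j
  exact (key j).trans (Nat.lt_succ_iff.mp j.isLt)

theorem reversedDeutschPaths_finite (n i : ℕ) : (reversedDeutschPaths n i).Finite := by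
  refine (Set.finite_Iic (fun _ : Fin (n + 1) => i + n)).subset ?_
  rintro c ⟨-, hl, hs⟩
  have key : ∀ j : Fin (n + 1), c j + j ≤ i + n := by
    intro j
    induction j using Fin.reverseInduction with
    | last => simp [hl]
    | cast j ih =>
      simp only [Fin.val_castSucc, Fin.val_succ] at ih ⊢
      rcases hs j with h | ⟨k, h⟩ <;> omega
  intro j
  have := key j
  show c j ≤ i + n
  omega

/-- `f_i(z)`: the generating function, by length, of the Deutsch paths ending at level `i`. -/
noncomputable def deutschGF (i : ℕ) : ℚ⟦X⟧ :=
  PowerSeries.mk fun n => ((deutschPaths n i).ncard : ℚ)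

/-- `g_i(z)`: the generating function, by length, of the reversed Deutsch paths
ending at level `i`. -/
noncomputable def reversedDeutschGF (i : ℕ) : ℚ⟦X⟧ :=
  PowerSeries.mk fun n => ((reversedDeutschPaths n i).ncard : ℚ)

/-- The area of a path: the sum of all its ordinates. -/
def pathArea {n : ℕ} (c : Fin (n + 1) → ℕ) : ℕ := ∑ j, c j

/-- The total area, summed over all Deutsch paths of length `m` that return to the `x`-axis. -/
noncomputable def totalArea (m : ℕ) : ℕ :=
  ∑ c ∈ (deutschPaths_finite m 0).toFinset, pathArea c

/-- The generating function of the total area; the variable marks the length of the paths. -/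
noncomputable def areaGF : ℚ⟦X⟧ :=
  PowerSeries.mk fun m => (totalArea m : ℚ)

/-- `S` is the formal sum of the series `F 0, F 1, F 2, …`: for each power of the variable only
finitely many of them contribute to its coefficient, and the contributions add up
to the coefficient in `S`. -/
def IsFormalSum (F : ℕ → ℚ⟦X⟧) (S : ℚ⟦X⟧) : Prop :=
  ∀ m : ℕ, (Function.support fun i => PowerSeries.coeff m (F i)).Finite ∧
    PowerSeries.coeff m S = ∑ᶠ i, PowerSeries.coeff m (F i)

/-- Binomial coefficients with integer entries, equal to `0` if the lower entry is negative. -/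
noncomputable def intBinom (a b : ℤ) : ℤ :=
  if 0 ≤ b then Ring.choose a b.toNat else 0

/-!
Cutting a Deutsch path that returns to level `0` at each of its vertices in turn, and reading the
second part backwards, gives `AREA = ∑ i * f_i * g_i` (`sum_levelArea_mul_reversedCount`,
`totalArea_eq_sum`). The proof is a transfer-matrix argument: it only uses the decomposition of a
path by its last step, and that a reversed step from `a` to `b` is a step from `b` to `a`.

Comparing the steps into levels `i` and `i + 2` turns the infinite families of steps into
three-term recurrences. With `z ^ 2 = t * (1 - t) ^ 2` and `x = z / (1 - t)` one has `t = x ^ 2` and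
`z = x - x ^ 3`, and the recurrences are solved by `f_i = x ^ i / (1 - t)` (`deutschGF_eq`) and, for
`g_i`, by a second-order sequence with coefficients in `x` and `(1 - t)⁻¹`
(`reversedDeutschGF_eq`). Hence `(1 - t) * f_i * g_i = x ^ i * g_i` satisfies a second-order
recurrence too, and summation by parts (`sum_natCast_mul_add_remainder`) evaluates `∑ i * f_i * g_i`
up to a remainder divisible by any given power of `z`; this is the closed form `areaGF_mul_eq`.

The coefficients follow from the form
`[z ^ (2 * n)] F(t) * (1 - t) / (1 - 3 * t) = [w ^ n] F(w) / (1 - w) ^ (2 * n)` of Lagrange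
inversion (`coeff_algHom_mul_eq`), applied to `F = w * (1 + 3 * w) / ((1 - w) ^ 2 * (1 - 3 * w))`.
-/

/-! ### Paths with steps in a given relation -/

/-- Sequences `c 0 = 0, c 1, …, c n = i` of nonnegative integers whose consecutive terms are
related by `R`; both families of paths are instances. -/
def relPaths (R : ℕ → ℕ → Prop) (n i : ℕ) : Set (Fin (n + 1) → ℕ) :=
  {c | c 0 = 0 ∧ c (Fin.last n) = i ∧ ∀ j : Fin n, R (c j.castSucc) (c j.succ)}

theorem snoc_mem_relPaths {R : ℕ → ℕ → Prop} {n k i : ℕ} {c : Fin (n + 1) → ℕ}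
    (hc : c ∈ relPaths R n k) (hR : R k i) :
    (Fin.snoc c i : Fin (n + 2) → ℕ) ∈ relPaths R (n + 1) i := by
  obtain ⟨h0, hl, hs⟩ := hc
  refine ⟨?_, Fin.snoc_last .., fun j => ?_⟩
  · rw [← Fin.castSucc_zero, Fin.snoc_castSucc, h0]
  · induction j using Fin.lastCases with
    | last => rw [Fin.succ_last, Fin.snoc_last, Fin.snoc_castSucc, hl]; exact hR
    | cast j => rw [Fin.succ_castSucc, Fin.snoc_castSucc, Fin.snoc_castSucc]; exact hs j

theorem init_mem_relPaths {R : ℕ → ℕ → Prop} {n i : ℕ} {c : Fin (n + 2) → ℕ}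
    (hc : c ∈ relPaths R (n + 1) i) :
    Fin.init c ∈ relPaths R n (c (Fin.last n).castSucc) ∧ R (c (Fin.last n).castSucc) i := by
  obtain ⟨h0, hl, hs⟩ := hc
  refine ⟨⟨by simpa [Fin.init] using h0, rfl, fun j => ?_⟩, ?_⟩
  · have := hs j.castSucc
    rwa [Fin.succ_castSucc] at this
  · have := hs (Fin.last n)
    rwa [Fin.succ_last, hl] at this

open Classical in
/-- Sorting the paths of length `n + 1` by their last step. The bound `N` makes the sum over the
level `k` of the last but one vertex finite. -/
theorem sum_relPaths_succ {M : Type*} [AddCommMonoid M] {R : ℕ → ℕ → Prop}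
    (hfin : ∀ n i, (relPaths R n i).Finite) (n i N : ℕ)
    (hN : ∀ k, R k i → (relPaths R n k).Nonempty → k < N) (w : (Fin (n + 2) → ℕ) → M) :
    ∑ c ∈ (hfin (n + 1) i).toFinset, w c =
      ∑ k ∈ (Finset.range N).filter (R · i), ∑ c ∈ (hfin n k).toFinset, w (Fin.snoc c i) := by
  rw [Finset.sum_sigma']
  refine Finset.sum_bij' (fun c _ => ⟨c (Fin.last n).castSucc, Fin.init c⟩)
    (fun p _ => Fin.snoc p.2 i) ?_ ?_ ?_ ?_ ?_
  · intro c hc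
    have h := init_mem_relPaths ((hfin _ _).mem_toFinset.1 hc)
    simp only [Finset.mem_sigma, Finset.mem_filter, Finset.mem_range, Set.Finite.mem_toFinset]
    exact ⟨⟨hN _ h.2 ⟨_, h.1⟩, h.2⟩, h.1⟩
  · rintro ⟨k, c⟩ hp
    simp only [Finset.mem_sigma, Finset.mem_filter, Finset.mem_range,
      Set.Finite.mem_toFinset] at hp ⊢
    exact snoc_mem_relPaths hp.2 hp.1.2
  · intro c hc
    have h := ((hfin _ _).mem_toFinset.1 hc).2.1
    subst h
    exact Fin.snoc_init_self c
  · rintro ⟨k, c⟩ hp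
    simp only [Finset.mem_sigma, Set.Finite.mem_toFinset] at hp
    obtain ⟨-, -, rfl, -⟩ := hp
    simp [Fin.snoc_castSucc, Fin.init_snoc]
  · intro c hc
    have h := ((hfin _ _).mem_toFinset.1 hc).2.1
    subst h
    simp [Fin.snoc_init_self]

theorem relPaths_zero (R : ℕ → ℕ → Prop) (i : ℕ) :
    relPaths R 0 i = if i = 0 then {fun _ => 0} else ∅ := by
  have : Subsingleton (Fin (0 + 1)) := inferInstanceAs (Subsingleton (Fin 1))
  ext c
  have hc : c = (fun _ => 0) ↔ c 0 = 0 := by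
    refine ⟨fun h => by rw [h], fun h => funext fun j => ?_⟩
    rw [Subsingleton.elim j 0, h]
  split_ifs with h
  · subst h
    simp [relPaths, hc, Subsingleton.elim (Fin.last 0) 0]
  · simp only [relPaths, Set.mem_ofPred_eq, Set.mem_empty_iff_false, iff_false,
      Subsingleton.elim (Fin.last 0) 0]
    rintro ⟨h0, h1, -⟩
    exact h (h1 ▸ h0)

/-! ### Counting Deutsch paths by their last step -/

/-- The number of Deutsch paths of length `n` ending at level `i`. -/
noncomputable def deutschCount (n i : ℕ) : ℕ := (deutschPaths n i).ncard

/-- The number of reversed Deutsch paths of length `n` ending at level `i`. -/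
noncomputable def reversedCount (n i : ℕ) : ℕ := (reversedDeutschPaths n i).ncard

/-- The total area of the Deutsch paths of length `n` ending at level `i`. -/
noncomputable def levelArea (n i : ℕ) : ℕ :=
  ∑ c ∈ (deutschPaths_finite n i).toFinset, pathArea c

theorem le_of_deutschPaths_nonempty {n i : ℕ} (h : (deutschPaths n i).Nonempty) : i ≤ n := by
  obtain ⟨c, h0, rfl, hs⟩ := h
  have key : ∀ j : Fin (n + 1), c j ≤ j := by
    intro j
    induction j using Fin.induction with
    | zero => simp [h0]
    | succ j ih =>
      simp only [Fin.val_castSucc, Fin.val_succ] at ih ⊢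
      rcases hs j with h | ⟨k, h⟩ <;> omega
  simpa using key (Fin.last n)

theorem deutschCount_eq_zero {n i : ℕ} (h : n < i) : deutschCount n i = 0 := by
  rw [deutschCount, Set.ncard_eq_zero (deutschPaths_finite n i), ← Set.not_nonempty_iff_eq_empty]
  exact fun hne => (le_of_deutschPaths_nonempty hne).not_gt h

theorem levelArea_eq_zero {n i : ℕ} (h : n < i) : levelArea n i = 0 := by
  refine Finset.sum_eq_zero fun c hc => absurd ?_ h.not_ge
  exact le_of_deutschPaths_nonempty ⟨c, (Set.Finite.mem_toFinset _).1 hc⟩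

theorem deutschCount_zero (i : ℕ) : deutschCount 0 i = if i = 0 then 1 else 0 := by
  rw [deutschCount, show deutschPaths 0 i = relPaths IsDeutschStep 0 i from rfl, relPaths_zero]
  split_ifs <;> simp

theorem reversedCount_zero (i : ℕ) : reversedCount 0 i = if i = 0 then 1 else 0 := by
  rw [reversedCount,
    show reversedDeutschPaths 0 i = relPaths IsReversedDeutschStep 0 i from rfl, relPaths_zero]
  split_ifs <;> simp

theorem levelArea_zero (i : ℕ) : levelArea 0 i = 0 := by
  refine Finset.sum_eq_zero fun c hc => ?_
  have h := ((Set.Finite.mem_toFinset _).1 hc).1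
  simp [pathArea, h]

open Classical in
theorem deutschCount_succ {n N : ℕ} (hN : n < N) (i : ℕ) :
    deutschCount (n + 1) i =
      ∑ k ∈ (Finset.range N).filter (IsDeutschStep · i), deutschCount n k := by
  simp only [deutschCount, Set.ncard_eq_toFinset_card _ (deutschPaths_finite _ _),
    Finset.card_eq_sum_ones]
  exact sum_relPaths_succ (R := IsDeutschStep) deutschPaths_finite n i N
    (fun k _ hk => (le_of_deutschPaths_nonempty hk).trans_lt hN) (fun _ => 1)

open Classical in
theorem reversedCount_succ {i N : ℕ} (hN : i + 1 < N) (n : ℕ) :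
    reversedCount (n + 1) i =
      ∑ k ∈ (Finset.range N).filter (IsReversedDeutschStep · i), reversedCount n k := by
  simp only [reversedCount, Set.ncard_eq_toFinset_card _ (reversedDeutschPaths_finite _ _),
    Finset.card_eq_sum_ones]
  refine sum_relPaths_succ (R := IsReversedDeutschStep) reversedDeutschPaths_finite n i N
    (fun k hk _ => ?_) (fun _ => 1)
  rcases hk with h | ⟨j, h⟩ <;> omega

open Classical in
theorem levelArea_succ {n N : ℕ} (hN : n < N) (i : ℕ) :
    levelArea (n + 1) i =
      ∑ k ∈ (Finset.range N).filter (IsDeutschStep · i), levelArea n k +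
        i * deutschCount (n + 1) i := by
  rw [deutschCount_succ hN, Finset.mul_sum, ← Finset.sum_add_distrib, levelArea]
  refine (sum_relPaths_succ (R := IsDeutschStep) deutschPaths_finite n i N
    (fun k _ hk => (le_of_deutschPaths_nonempty hk).trans_lt hN) pathArea).trans
    (Finset.sum_congr rfl fun k _ => ?_)
  have hsnoc : ∀ c : Fin (n + 1) → ℕ,
      pathArea (Fin.snoc c i : Fin (n + 2) → ℕ) = pathArea c + i := by
    intro c
    simp [pathArea, Fin.sum_univ_castSucc (n := n + 1), Fin.snoc_castSucc, Fin.snoc_last]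
  simp only [hsnoc, Finset.sum_add_distrib, Finset.sum_const, smul_eq_mul]
  rw [deutschCount, Set.ncard_eq_toFinset_card _ (deutschPaths_finite _ _), mul_comm i]
  rfl

theorem isDeutschStep_iff (k i : ℕ) : IsDeutschStep k i ↔ k + 1 = i ∨ IsDeutschStep k (i + 2) := by
  constructor
  · rintro (h | ⟨j, h⟩)
    · exact .inl h.symm
    · rcases j with _ | j
      · exact .inr (.inl (by omega))
      · exact .inr (.inr ⟨j, by omega⟩)
  · rintro (h | h | ⟨j, h⟩)
    · exact .inl h.symm
    · exact .inr ⟨0, by omega⟩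
    · exact .inr ⟨j + 1, by omega⟩

theorem isReversedDeutschStep_add_two_iff (k i : ℕ) :
    IsReversedDeutschStep k (i + 2) ↔ k = i + 3 ∨ IsReversedDeutschStep k i := by
  constructor
  · rintro (h | ⟨j, h⟩)
    · exact .inl h
    · rcases j with _ | j
      · exact .inr (.inl (by omega))
      · exact .inr (.inr ⟨j, by omega⟩)
  · rintro (h | h | ⟨j, h⟩)
    · exact .inl h
    · exact .inr ⟨0, by omega⟩
    · exact .inr ⟨j + 1, by omega⟩

/-- The infinitely many down-steps telescope: levels `i` and `i + 2` are reached by the same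
steps, except for the up-step to level `i`. -/
theorem deutschCount_succ_eq_add (n i : ℕ) :
    deutschCount (n + 1) i =
      deutschCount (n + 1) (i + 2) + if i = 0 then 0 else deutschCount n (i - 1) := by
  classical
  have hN : n < n + i + 2 := by omega
  rw [deutschCount_succ hN i, deutschCount_succ hN (i + 2)]
  rcases i with _ | i
  · simp only [if_true, add_zero]
    refine Finset.sum_congr (Finset.filter_congr fun k _ => ?_) fun _ _ => rfl
    rw [isDeutschStep_iff k 0]
    simp
  · rw [if_neg (by omega), Nat.add_sub_cancel, ← Finset.sum_filter_add_sum_filter_not _ (· = i)]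
    rw [add_comm]
    congr 1
    · refine Finset.sum_congr ?_ fun _ _ => rfl
      ext k
      have h1 := isDeutschStep_iff k (i + 1)
      have h2 : k = i → ¬ IsDeutschStep k (i + 1 + 2) := by
        rintro rfl (h | ⟨j, h⟩) <;> omega
      simp only [Finset.mem_filter, Finset.mem_range, h1]
      grind
    · rw [show ((Finset.range (n + (i + 1) + 2)).filter (IsDeutschStep · (i + 1))).filter (· = i)
        = {i} from ?_, Finset.sum_singleton]
      ext k
      simp only [Finset.mem_filter, Finset.mem_range, Finset.mem_singleton]
      refine ⟨fun h => h.2, fun h => ⟨⟨by omega, .inl (by omega)⟩, h⟩⟩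

theorem reversedCount_succ_zero (n : ℕ) : reversedCount (n + 1) 0 = reversedCount n 1 := by
  classical
  rw [reversedCount_succ (show 0 + 1 < 2 by omega), show
    (Finset.range 2).filter (IsReversedDeutschStep · 0) = {1} from ?_, Finset.sum_singleton]
  ext k
  simp only [Finset.mem_filter, Finset.mem_range, Finset.mem_singleton]
  refine ⟨?_, fun h => ⟨by omega, .inl (by omega)⟩⟩
  rintro ⟨-, h | ⟨j, h⟩⟩ <;> omega

theorem reversedCount_succ_one (n : ℕ) :
    reversedCount (n + 1) 1 = reversedCount n 0 + reversedCount n 2 := by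
  classical
  rw [reversedCount_succ (show 1 + 1 < 3 by omega), show
    (Finset.range 3).filter (IsReversedDeutschStep · 1) = {0, 2} from ?_,
    Finset.sum_pair (by decide)]
  ext k
  simp only [Finset.mem_filter, Finset.mem_range, Finset.mem_insert, Finset.mem_singleton]
  constructor
  · rintro ⟨-, h | ⟨j, h⟩⟩ <;> omega
  · rintro (h | h)
    · exact ⟨by omega, .inr ⟨0, by omega⟩⟩
    · exact ⟨by omega, .inl (by omega)⟩

/-- The infinitely many up-steps telescope as well: levels `i` and `i + 2` are reached by the same
steps, except for the down-step to level `i + 2`. -/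
theorem reversedCount_succ_add_two (n i : ℕ) :
    reversedCount (n + 1) (i + 2) = reversedCount n (i + 3) + reversedCount (n + 1) i := by
  classical
  have hN : i + 2 + 1 < i + 4 := by omega
  rw [reversedCount_succ hN, reversedCount_succ (show i + 1 < i + 4 by omega),
    show (Finset.range (i + 4)).filter (IsReversedDeutschStep · (i + 2)) =
      insert (i + 3) ((Finset.range (i + 4)).filter (IsReversedDeutschStep · i)) from ?_,
    Finset.sum_insert]
  · simp only [Finset.mem_filter, not_and]
    rintro - (h | ⟨j, h⟩) <;> omega
  · ext k
    simp only [Finset.mem_filter, Finset.mem_range, Finset.mem_insert,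
      isReversedDeutschStep_add_two_iff]
    constructor
    · rintro ⟨h1, h | h⟩
      exacts [.inl h, .inr ⟨h1, h⟩]
    · rintro (h | h)
      exacts [⟨by omega, .inl h⟩, ⟨h.1, .inr h.2⟩]

/-! ### Cutting a path at a vertex -/

/-- Cutting a path at one of its vertices. A Deutsch path of length `n` to level `k`, followed by a
reversed Deutsch path of length `r` to level `k` read backwards, is a Deutsch path of length `n + r`
returning to level `0`; both sides count the area below the first `n + 1` vertices of such paths.
For `r = 0` this is the total area. -/
theorem sum_levelArea_mul_reversedCount (n r N : ℕ) (hN : n < N) :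
    ∑ k ∈ Finset.range N, levelArea n k * reversedCount r k =
      ∑ j ∈ Finset.range (n + 1), ∑ k ∈ Finset.range N,
        k * deutschCount j k * reversedCount (n - j + r) k := by
  classical
  induction n generalizing r with
  | zero =>
    have h : ∀ k, k * deutschCount 0 k = 0 := fun k => by
      rw [deutschCount_zero]; split_ifs with h <;> simp [h]
    simp [levelArea_zero, h]
  | succ n ih =>
    rw [Finset.sum_range_succ]
    simp only [levelArea_succ (show n < N by omega), add_mul, Finset.sum_add_distrib,
      Nat.sub_self, zero_add]
    congr 1
    -- the last step of the first part becomes the last step of the second part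
    have hswap : ∑ i ∈ Finset.range N, (∑ k ∈ (Finset.range N).filter (IsDeutschStep · i),
        levelArea n k) * reversedCount r i =
        ∑ k ∈ Finset.range N, levelArea n k * reversedCount (r + 1) k := by
      simp only [Finset.sum_mul, Finset.sum_filter]
      rw [Finset.sum_comm]
      refine Finset.sum_congr rfl fun k _ => ?_
      rcases lt_or_ge n k with hk | hk
      · simp [levelArea_eq_zero hk]
      · rw [reversedCount_succ (show k + 1 < N by omega), Finset.mul_sum, Finset.sum_filter]
        exact Finset.sum_congr rfl fun i _ => by rw [ite_mul, zero_mul]; rfl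
    rw [hswap, ih (r + 1) (by omega)]
    refine Finset.sum_congr rfl fun j hj => Finset.sum_congr rfl fun k _ => ?_
    rw [Finset.mem_range] at hj
    rw [show n - j + (r + 1) = n + 1 - j + r by omega]

theorem totalArea_eq_sum {m N : ℕ} (hN : m < N) :
    totalArea m = ∑ k ∈ Finset.range N, ∑ p ∈ Finset.HasAntidiagonal.antidiagonal m,
      k * deutschCount p.1 k * reversedCount p.2 k := by
  have h := sum_levelArea_mul_reversedCount m 0 N hN
  simp only [reversedCount_zero, mul_ite, mul_one, mul_zero, Finset.sum_ite_eq',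
    Finset.mem_range.2 (Nat.zero_lt_of_lt hN), if_true] at h
  rw [show totalArea m = levelArea m 0 from rfl, h, Finset.sum_comm]
  refine Finset.sum_congr rfl fun k _ => ?_
  rw [Finset.Nat.sum_antidiagonal_eq_sum_range_succ_mk]
  rfl

/-! ### Closed forms of the generating functions -/

theorem coeff_deutschGF (n i : ℕ) : PowerSeries.coeff n (deutschGF i) = deutschCount n i :=
  PowerSeries.coeff_mk ..

theorem coeff_reversedDeutschGF (n i : ℕ) :
    PowerSeries.coeff n (reversedDeutschGF i) = reversedCount n i :=
  PowerSeries.coeff_mk ..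

/-- The recurrence for the `f_i` has other solutions; divisibility by `X ^ i` singles out the
combinatorial one. -/
theorem eq_deutschGF {h : ℕ → ℚ⟦X⟧} (hdvd : ∀ i, PowerSeries.X ^ i ∣ h i) (h0 : h 0 = h 2 + 1)
    (hs : ∀ i, h (i + 1) = h (i + 3) + PowerSeries.X * h i) (i : ℕ) : deutschGF i = h i := by
  have hlow : ∀ n i, n < i → PowerSeries.coeff n (h i) = 0 := fun n i hn =>
    PowerSeries.X_pow_dvd_iff.1 (hdvd i) n hn
  suffices H : ∀ n i, (deutschCount n i : ℚ) = PowerSeries.coeff n (h i) by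
    ext n; rw [coeff_deutschGF, H]
  intro n
  induction n with
  | zero =>
    intro i
    rcases i with _ | i
    · rw [h0, map_add, hlow 0 2 (by norm_num)]
      simp [deutschCount_zero]
    · rw [hlow 0 (i + 1) (by omega)]
      simp [deutschCount_zero]
  | succ n ih =>
    suffices H : ∀ m i, n + 1 < i + m →
        (deutschCount (n + 1) i : ℚ) = PowerSeries.coeff (n + 1) (h i) from
      fun i => H (n + 2) i (by omega)
    intro m
    induction m with
    | zero =>
      intro i hi
      rw [add_zero] at hi
      rw [deutschCount_eq_zero (n := n + 1) hi, hlow (n + 1) i hi, Nat.cast_zero]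
    | succ m ihm =>
      intro i hi
      rw [deutschCount_succ_eq_add, Nat.cast_add, ihm (i + 2) (by omega)]
      rcases i with _ | i
      · rw [h0]
        simp [PowerSeries.coeff_one]
      · rw [hs i, map_add, PowerSeries.coeff_succ_X_mul, ← ih i]
        simp

theorem eq_reversedDeutschGF {h : ℕ → ℚ⟦X⟧} (h0 : h 0 = 1 + PowerSeries.X * h 1)
    (h1 : h 1 = PowerSeries.X * (h 0 + h 2)) (h2 : h 2 = h 0 - 1 + PowerSeries.X * h 3)
    (hs : ∀ i, h (i + 3) = h (i + 1) + PowerSeries.X * h (i + 4)) (i : ℕ) :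
    reversedDeutschGF i = h i := by
  suffices H : ∀ n i, (reversedCount n i : ℚ) = PowerSeries.coeff n (h i) by
    ext n; rw [coeff_reversedDeutschGF, H]
  intro n
  induction n with
  | zero =>
    have e0 : PowerSeries.coeff 0 (h 0) = 1 := by rw [h0]; simp
    have e1 : PowerSeries.coeff 0 (h 1) = 0 := by rw [h1]; simp
    have e2 : PowerSeries.coeff 0 (h 2) = 0 := by rw [h2, map_add, map_sub, e0]; simp
    have e : ∀ i, PowerSeries.coeff 0 (h (i + 1)) = 0 ∧ PowerSeries.coeff 0 (h (i + 2)) = 0 := by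
      intro i
      induction i with
      | zero => exact ⟨e1, e2⟩
      | succ i ihi =>
        refine ⟨ihi.2, ?_⟩
        rw [show i + 1 + 2 = i + 3 from rfl, hs i, map_add, ihi.1]
        simp
    intro i
    rcases i with _ | i
    · simp [reversedCount_zero, e0]
    · simp [reversedCount_zero, (e i).1]
  | succ n ih =>
    have e0 : (reversedCount (n + 1) 0 : ℚ) = PowerSeries.coeff (n + 1) (h 0) := by
      rw [reversedCount_succ_zero, h0, map_add, PowerSeries.coeff_succ_X_mul, ← ih 1]
      simp [PowerSeries.coeff_one]
    have e1 : (reversedCount (n + 1) 1 : ℚ) = PowerSeries.coeff (n + 1) (h 1) := by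
      rw [reversedCount_succ_one, h1, PowerSeries.coeff_succ_X_mul, map_add, ← ih 0, ← ih 2,
        Nat.cast_add]
    have e2 : (reversedCount (n + 1) 2 : ℚ) = PowerSeries.coeff (n + 1) (h 2) := by
      rw [reversedCount_succ_add_two n 0, h2, map_add, PowerSeries.coeff_succ_X_mul, map_sub,
        ← ih 3, ← e0, Nat.cast_add]
      simp [PowerSeries.coeff_one, add_comm]
    have e : ∀ i, (reversedCount (n + 1) (i + 1) : ℚ) = PowerSeries.coeff (n + 1) (h (i + 1)) ∧
        (reversedCount (n + 1) (i + 2) : ℚ) = PowerSeries.coeff (n + 1) (h (i + 2)) := by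
      intro i
      induction i with
      | zero => exact ⟨e1, e2⟩
      | succ i ihi =>
        refine ⟨ihi.2, ?_⟩
        rw [show i + 1 + 2 = i + 3 from rfl, hs i, map_add, PowerSeries.coeff_succ_X_mul, ← ihi.1,
          ← ih (i + 4), reversedCount_succ_add_two n (i + 1), Nat.cast_add, add_comm]
    intro i
    rcases i with _ | i
    exacts [e0, (e i).1]

/-- The solution of the recurrence for the `g_i`, in terms of `x` and `v`, where `v` stands for
`(1 - x ^ 2)⁻¹`: it satisfies `(1 - x ^ 2) * g (i + 2) = x * g (i + 1) + g i`, with an additional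
term `-1` on the right for `i = 0`. -/
noncomputable def reversedSolution (x v : ℚ⟦X⟧) : ℕ → ℚ⟦X⟧
  | 0 => v
  | 1 => x * v ^ 2
  | 2 => v * (x * (x * v ^ 2) + v - 1)
  | i + 3 => v * (x * reversedSolution x v (i + 2) + reversedSolution x v (i + 1))

section ClosedForms

variable {t x v : ℚ⟦X⟧} (hx : x * (1 - t) = PowerSeries.X) (hx2 : x ^ 2 = t) (hv : (1 - t) * v = 1)
include hx hx2 hv

/-- With `x = z / (1 - t)` one has `x ^ 2 = t` and `x - x ^ 3 = z`, so `x` is the root of the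
characteristic equation `y ^ 3 - y + z = 0` that is divisible by `z`. -/
theorem deutschGF_eq (i : ℕ) : deutschGF i = x ^ i * v := by
  have hXx : PowerSeries.X ∣ x := ⟨v, by rw [← hx]; linear_combination -x * hv⟩
  refine eq_deutschGF (h := fun i => x ^ i * v) (fun i => ?_) ?_ (fun i => ?_) i
  · exact (pow_dvd_pow_of_dvd hXx i).mul_right v
  · linear_combination hv - v * hx2
  · rw [← hx]
    linear_combination -x ^ (i + 1) * v * hx2

theorem reversedDeutschGF_eq (i : ℕ) : reversedDeutschGF i = reversedSolution x v i := by
  have hv' : (1 - x ^ 2) * v = 1 := by rw [hx2, hv]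
  have key (r : ℚ⟦X⟧) : PowerSeries.X * (v * r) = x * r := by
    rw [← hx]; linear_combination x * r * hv
  refine eq_reversedDeutschGF ?_ ?_ ?_ (fun i => ?_) i
  · simp only [reversedSolution]
    rw [← hx, ← hx2]
    linear_combination hv' - x ^ 2 * v * hv'
  · simp only [reversedSolution]
    rw [← hx, ← hx2]
    linear_combination (x * v - x * (x ^ 2 * v ^ 2 + v)) * hv'
  · simp only [reversedSolution]
    rw [key]
    linear_combination (v * x ^ 2 * v + v - 1) * hv'
  · simp only [reversedSolution]
    rw [key]
    linear_combination (x * reversedSolution x v (i + 2) + reversedSolution x v (i + 1)) * hv'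

end ClosedForms

/-! ### The area series -/

/-- Summation by parts for `∑ i * u i`, where `u` satisfies a second-order recurrence: the remainder
after `N` terms is a combination of the next two values of `u`. -/
theorem sum_natCast_mul_add_remainder {R : Type*} [CommRing R] {t : R} {u : ℕ → R}
    (hu : ∀ i, (1 - t) * u (i + 3) = t * (u (i + 2) + u (i + 1))) (N : ℕ) :
    (1 - 3 * t) ^ 2 * ∑ i ∈ Finset.range (N + 1), (i : R) * u i +
      ((t * ((1 - 3 * t) * (N + 2) + 1) + (N + 1) * (1 - 3 * t) ^ 2) * u (N + 1) +
        ((1 - 3 * t) * (N + 1) + 1) * ((1 - t) * u (N + 2))) =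
      (t * ((1 - 3 * t) * 2 + 1) + (1 - 3 * t) ^ 2) * u 1 +
        ((1 - 3 * t) + 1) * ((1 - t) * u 2) := by
  induction N with
  | zero => simp
  | succ N ih =>
    rw [← ih, Finset.sum_range_succ _ (N + 1)]
    push_cast
    linear_combination ((1 - 3 * t) * (N + 2) + 1) * hu N

theorem dvd_sub_sum_deutschGF_mul_reversedDeutschGF (N : ℕ) :
    PowerSeries.X ^ N ∣ areaGF -
      ∑ i ∈ Finset.range (N + 1), (i : ℚ⟦X⟧) * deutschGF i * reversedDeutschGF i := by
  rw [PowerSeries.X_pow_dvd_iff]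
  intro m hm
  rw [map_sub, areaGF, PowerSeries.coeff_mk, totalArea_eq_sum (show m < N + 1 by omega), map_sum,
    sub_eq_zero]
  push_cast
  refine Finset.sum_congr rfl fun i _ => ?_
  rw [mul_assoc, ← map_natCast (PowerSeries.C (R := ℚ)), PowerSeries.coeff_C_mul,
    PowerSeries.coeff_mul, Finset.mul_sum]
  refine Finset.sum_congr rfl fun p _ => ?_
  rw [coeff_deutschGF, coeff_reversedDeutschGF, mul_assoc]

theorem isFormalSum_areaGF :
    IsFormalSum (fun i => (i : ℚ⟦X⟧) * deutschGF i * reversedDeutschGF i) areaGF := by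
  intro m
  have hsupp : (Function.support fun i : ℕ => PowerSeries.coeff m
      ((i : ℚ⟦X⟧) * deutschGF i * reversedDeutschGF i)) ⊆ Finset.range (m + 2) := by
    intro i hi
    by_contra hlt
    rw [Finset.coe_range, Set.mem_Iio, not_lt] at hlt
    refine hi ?_
    have hdvd : PowerSeries.X ^ (m + 1) ∣ deutschGF i :=
      PowerSeries.X_pow_dvd_iff.2 fun k hk => by
        rw [coeff_deutschGF, deutschCount_eq_zero (by omega), Nat.cast_zero]
    exact PowerSeries.X_pow_dvd_iff.1 ((hdvd.mul_left _).mul_right _) m (by omega)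
  refine ⟨(Finset.finite_toSet _).subset hsupp, ?_⟩
  rw [finsum_eq_sum_of_support_subset _ hsupp, ← map_sum, ← sub_eq_zero, ← map_sub]
  exact PowerSeries.X_pow_dvd_iff.1
    (dvd_sub_sum_deutschGF_mul_reversedDeutschGF (m + 1)) m (by omega)

theorem areaGF_mul_eq {t : ℚ⟦X⟧} (h0 : PowerSeries.constantCoeff t = 0)
    (ht : t * (1 - t) ^ 2 = PowerSeries.X ^ 2) :
    areaGF * ((1 - t) * (1 - 3 * t) ^ 2) = t * (1 + 3 * t) := by
  obtain ⟨v, hv⟩ : ∃ v, (1 - t) * v = 1 :=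
    ⟨(1 - t)⁻¹, PowerSeries.mul_inv_cancel _ (by simp [h0])⟩
  obtain ⟨x, hxv⟩ : ∃ x, x = PowerSeries.X * v := ⟨_, rfl⟩
  have hx : x * (1 - t) = PowerSeries.X := by rw [hxv]; linear_combination PowerSeries.X * hv
  have hx2 : x ^ 2 = t := by
    rw [hxv, mul_pow, ← ht]
    linear_combination t * ((1 - t) * v + 1) * hv
  set g := reversedSolution x v with hg
  have hg2 : (1 - t) * g 2 = x * (x * v ^ 2) + v - 1 := by
    simp only [hg, reversedSolution]
    linear_combination (x * (x * v ^ 2) + v - 1) * hv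
  have hg3 : ∀ i, (1 - t) * g (i + 3) = x * g (i + 2) + g (i + 1) := by
    intro i
    simp only [hg, reversedSolution]
    linear_combination (x * reversedSolution x v (i + 2) + reversedSolution x v (i + 1)) * hv
  have hu : ∀ i, (1 - t) * (x ^ (i + 3) * g (i + 3)) =
      t * (x ^ (i + 2) * g (i + 2) + x ^ (i + 1) * g (i + 1)) := by
    intro i
    rw [← hx2] at hg3 ⊢
    linear_combination x ^ (i + 3) * hg3 i
  rw [← sub_eq_zero]
  ext n
  have hXx : PowerSeries.X ∣ x := ⟨v, hxv⟩
  have hsum := sum_natCast_mul_add_remainder (u := fun i => x ^ i * g i) hu (n + 1)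
  have hval : (t * ((1 - 3 * t) * 2 + 1) + (1 - 3 * t) ^ 2) * (x ^ 1 * g 1) +
      ((1 - 3 * t) + 1) * ((1 - t) * (x ^ 2 * g 2)) = t * (1 + 3 * t) := by
    have e1 : g 1 = x * v ^ 2 := by simp only [hg, reversedSolution]
    rw [e1, show (1 - t) * (x ^ 2 * g 2) = x ^ 2 * ((1 - t) * g 2) by ring, hg2,
      show x ^ 2 * (x * (x * v ^ 2) + v - 1) = x ^ 2 * (x ^ 2 * v ^ 2 + v - 1) by ring,
      show x ^ 1 * (x * v ^ 2) = x ^ 2 * v ^ 2 by ring, hx2]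
    -- clearing the denominator `(1 - t) ^ 2`
    have hv2 : (1 - t) ^ 2 * v ^ 2 = 1 := by rw [← mul_pow, hv, one_pow]
    have hw : v = (1 - t) * v ^ 2 := by linear_combination -v * hv
    linear_combination (t * (1 + 3 * t) + (2 - 3 * t) * t) * hv2 + (2 - 3 * t) * t * hw
  rw [hval] at hsum
  have hpart : (1 - t) * ∑ i ∈ Finset.range (n + 1 + 1),
        (i : ℚ⟦X⟧) * deutschGF i * reversedDeutschGF i =
      ∑ i ∈ Finset.range (n + 1 + 1), (i : ℚ⟦X⟧) * (x ^ i * g i) := by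
    rw [Finset.mul_sum]
    refine Finset.sum_congr rfl fun i _ => ?_
    rw [deutschGF_eq hx hx2 hv, reversedDeutschGF_eq hx hx2 hv]
    linear_combination (i : ℚ⟦X⟧) * x ^ i * g i * hv
  have hdvd : PowerSeries.X ^ (n + 1) ∣
      areaGF * ((1 - t) * (1 - 3 * t) ^ 2) - t * (1 + 3 * t) := by
    have hpow : ∀ k, PowerSeries.X ^ (n + 1) ∣ x ^ (n + 1 + k) * g (n + 1 + k) := fun k =>
      ((pow_dvd_pow _ (Nat.le_add_right _ _)).trans (pow_dvd_pow_of_dvd hXx _)).mul_right _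
    obtain ⟨p, hp⟩ := dvd_sub_sum_deutschGF_mul_reversedDeutschGF (n + 1)
    obtain ⟨a, ha⟩ := hpow 1
    obtain ⟨b, hb⟩ := hpow 2
    rw [ha, hb] at hsum
    refine ⟨(1 - t) * (1 - 3 * t) ^ 2 * p -
      (t * ((1 - 3 * t) * ((n + 1 : ℕ) + 2) + 1) + ((n + 1 : ℕ) + 1) * (1 - 3 * t) ^ 2) * a -
      ((1 - 3 * t) * ((n + 1 : ℕ) + 1) + 1) * (1 - t) * b, ?_⟩
    linear_combination (1 - t) * (1 - 3 * t) ^ 2 * hp + (1 - 3 * t) ^ 2 * hpart + hsum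
  exact PowerSeries.X_pow_dvd_iff.1 hdvd n (by omega)

/-! ### The substitution -/

theorem existsUnique_mul_one_sub_sq_eq :
    ∃! t : ℚ⟦X⟧, PowerSeries.constantCoeff t = 0 ∧ t * (1 - t) ^ 2 = PowerSeries.X ^ 2 := by
  refine existsUnique_of_exists_of_unique ?_ ?_
  · -- the compositional inverse of `X * (1 - X) ^ 2`, evaluated at `X ^ 2`
    set P : ℚ⟦X⟧ := PowerSeries.X * (1 - PowerSeries.X) ^ 2 with hP
    have hP0 : PowerSeries.constantCoeff P = 0 := by simp [hP]
    have hP1 : PowerSeries.coeff 1 P = 1 := by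
      rw [hP, ← zero_add 1, PowerSeries.coeff_succ_X_mul]; simp
    let _ : Invertible (PowerSeries.coeff 1 P) := invertibleOfNonzero (by rw [hP1]; exact one_ne_zero)
    have hs := PowerSeries.subst_substInv_right P hP0
    have hsub : PowerSeries.HasSubst P.substInv := PowerSeries.HasSubst.substInv P
    have hX : PowerSeries.HasSubst (PowerSeries.X ^ 2 : ℚ⟦X⟧) :=
      PowerSeries.HasSubst.X_pow two_ne_zero
    set s := P.substInv
    have hs' : s * (1 - s) ^ 2 = PowerSeries.X := by
      rw [← hs, hP, ← PowerSeries.coe_substAlgHom hsub]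
      simp [PowerSeries.substAlgHom_X]
    refine ⟨s.subst (PowerSeries.X ^ 2 : ℚ⟦X⟧), ?_, ?_⟩
    · have hX0 : PowerSeries.constantCoeff (PowerSeries.X ^ 2 : ℚ⟦X⟧) = 0 := by simp
      exact PowerSeries.constantCoeff_subst_eq_zero hX0 _ (PowerSeries.constantCoeff_substInv P)
    · have := congrArg (PowerSeries.substAlgHom hX) hs'
      rw [← PowerSeries.coe_substAlgHom hX]
      simpa [PowerSeries.substAlgHom_X] using this
  · rintro t s ⟨ht0, ht⟩ ⟨hs0, hs⟩
    have hmul : (t - s) * (1 - 2 * (t + s) + (t ^ 2 + t * s + s ^ 2)) = 0 := by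
      linear_combination ht - hs
    refine sub_eq_zero.1 ((mul_eq_zero.1 hmul).resolve_right fun h => ?_)
    have := congrArg PowerSeries.constantCoeff h
    simp [ht0, hs0] at this

/-! ### Lagrange inversion -/

theorem coeff_mk_one_pow (d n : ℕ) :
    PowerSeries.coeff n ((PowerSeries.mk 1 : ℚ⟦X⟧) ^ (d + 1)) = (d + n).choose d := by
  rw [PowerSeries.mk_one_pow_eq_mk_choose_add, PowerSeries.coeff_mk]

/-- The case of the inversion formula in which the left-hand side is constant. -/
theorem coeff_one_sub_three_X_mul_mk_one_pow (n : ℕ) :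
    PowerSeries.coeff (n + 1)
      ((1 - 3 * PowerSeries.X) * (PowerSeries.mk 1 : ℚ⟦X⟧) ^ (2 * n + 3)) = 0 := by
  have h := Nat.choose_mul_succ_eq (3 * n + 2) (2 * n + 2)
  rw [show 3 * n + 2 + 1 - (2 * n + 2) = n + 1 by omega] at h
  have h' : ((3 * n + 2).choose (2 * n + 2) : ℚ) * (3 * (n + 1)) =
      (3 * n + 3).choose (2 * n + 2) * (n + 1) := by exact_mod_cast h
  rw [show (1 - 3 * PowerSeries.X) * (PowerSeries.mk 1 : ℚ⟦X⟧) ^ (2 * n + 3) =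
      PowerSeries.mk 1 ^ (2 * n + 2 + 1) -
        PowerSeries.X * (PowerSeries.C (3 : ℚ) * PowerSeries.mk 1 ^ (2 * n + 2 + 1)) by
      rw [map_ofNat]; ring,
    map_sub, PowerSeries.coeff_succ_X_mul, PowerSeries.coeff_C_mul, coeff_mk_one_pow,
    coeff_mk_one_pow, show 2 * n + 2 + (n + 1) = 3 * n + 3 by ring,
    show 2 * n + 2 + n = 3 * n + 2 by ring]
  have hn : (n + 1 : ℚ) ≠ 0 := by positivity
  refine mul_right_cancel₀ hn ?_
  linear_combination -h'

/-- Lagrange inversion for `z ^ 2 = t * (1 - t) ^ 2`, where `F ↦ φ F` is the substitution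
`F ↦ F(t)`. Both sides are linear in `F` and compatible with `F ↦ X * (1 - X) ^ 2 * F`,
which raises `n` by one; so besides the constant coefficient one value of `F` that is a unit has to
be treated, and `(1 - 3 * X) / (1 - X)` makes both sides vanish for `n ≠ 0`. -/
theorem coeff_algHom_mul_eq {t r : ℚ⟦X⟧} (φ : ℚ⟦X⟧ →ₐ[ℚ] ℚ⟦X⟧) (hφ : φ PowerSeries.X = t)
    (h0 : PowerSeries.constantCoeff t = 0) (ht : t * (1 - t) ^ 2 = PowerSeries.X ^ 2)
    (hr : (1 - 3 * t) * r = 1) (n : ℕ) (F : ℚ⟦X⟧) :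
    PowerSeries.coeff (2 * n) (φ F * ((1 - t) * r)) =
      PowerSeries.coeff n (F * PowerSeries.mk 1 ^ (2 * n)) := by
  have hK : (PowerSeries.mk 1 : ℚ⟦X⟧) * (1 - PowerSeries.X) = 1 :=
    PowerSeries.mk_one_mul_one_sub_eq_one ℚ
  have hK0 : PowerSeries.constantCoeff (PowerSeries.mk 1 : ℚ⟦X⟧) = 1 := by simp
  have hφK : φ (PowerSeries.mk 1) * (1 - t) = 1 := by
    have := congrArg φ hK
    simpa [hφ] using this
  have hφC : ∀ c : ℚ, φ (PowerSeries.C c) = PowerSeries.C c := fun c => φ.commutes c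
  have hr0 : PowerSeries.constantCoeff r = 1 := by
    have := congrArg PowerSeries.constantCoeff hr
    simpa [h0] using this
  induction n generalizing F with
  | zero =>
    obtain ⟨Q, hQ⟩ : PowerSeries.X ∣ F - PowerSeries.C (PowerSeries.constantCoeff F) := by
      rw [PowerSeries.X_dvd_iff]; simp
    have hF : φ F = PowerSeries.C (PowerSeries.constantCoeff F) + t * φ Q := by
      rw [← hφ, ← map_mul, ← hQ, map_sub, hφC]; ring
    simp [hF, h0, hr0]
  | succ n ih =>
    set c := PowerSeries.constantCoeff F
    obtain ⟨Q, hQ⟩ : PowerSeries.X ∣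
        F - PowerSeries.C c * ((1 - 3 * PowerSeries.X) * PowerSeries.mk 1) := by
      rw [PowerSeries.X_dvd_iff]
      simp [c, hK0]
    set K : ℚ⟦X⟧ := PowerSeries.mk 1 with hKdef
    have hF : F = PowerSeries.C c * ((1 - 3 * PowerSeries.X) * K) + PowerSeries.X * Q := by
      rw [← hQ]; ring
    have hL : φ F * ((1 - t) * r) =
        PowerSeries.C c + PowerSeries.X ^ 2 * (φ (Q * K ^ 2) * ((1 - t) * r)) := by
      rw [hF, ← ht]
      simp only [map_add, map_mul, map_sub, map_pow, map_one, map_ofNat, hφ, hφC]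
      linear_combination (PowerSeries.C c * (1 - 3 * t) * r -
        t * φ Q * (1 - t) * r * (φ K * (1 - t) + 1)) * hφK + PowerSeries.C c * hr
    have hR : F * K ^ (2 * (n + 1)) =
        PowerSeries.C c * ((1 - 3 * PowerSeries.X) * K ^ (2 * n + 3)) +
          PowerSeries.X * ((Q * K ^ 2) * K ^ (2 * n)) := by
      rw [hF]; ring
    rw [hL, hR, map_add, map_add, PowerSeries.coeff_C_mul, PowerSeries.coeff_succ_X_mul, ← ih,
      coeff_one_sub_three_X_mul_mk_one_pow, show 2 * (n + 1) = 2 * n + 2 by ring,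
      PowerSeries.coeff_X_pow_mul, PowerSeries.coeff_C, if_neg (by omega), mul_zero]

/-! ### The coefficients of the area series -/

theorem intBinom_natCast (a b : ℕ) : intBinom a b = a.choose b := by
  simp [intBinom, Ring.choose_natCast]

theorem intBinom_of_neg {a b : ℤ} (hb : b < 0) : intBinom a b = 0 := if_neg hb.not_ge

theorem coeff_mul_mk_three_pow_mul_mk_one_pow (n : ℕ) :
    PowerSeries.coeff n (PowerSeries.X * (1 + 3 * PowerSeries.X) *
      (PowerSeries.mk fun k => (3 : ℚ) ^ k) * PowerSeries.mk 1 ^ (2 * n + 2)) =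
    ((∑ k ∈ Finset.range n, (3 : ℤ) ^ k *
      (intBinom (3 * n - k) (n - 1 - k) + 3 * intBinom (3 * n - 1 - k) (n - 2 - k)) : ℤ) : ℚ) := by
  rcases n with _ | m
  · simp
  set B : ℚ⟦X⟧ := PowerSeries.mk 1 ^ (2 * (m + 1) + 1 + 1) with hB
  rw [show PowerSeries.X * (1 + 3 * PowerSeries.X) * (PowerSeries.mk fun k => (3 : ℚ) ^ k) * B =
      PowerSeries.X * ((PowerSeries.mk fun k => (3 : ℚ) ^ k) *
        (B + PowerSeries.C (3 : ℚ) * (PowerSeries.X * B))) by rw [map_ofNat]; ring,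
    PowerSeries.coeff_succ_X_mul, PowerSeries.coeff_mul,
    Finset.Nat.sum_antidiagonal_eq_sum_range_succ_mk, Int.cast_sum]
  refine Finset.sum_congr rfl fun k hk => ?_
  obtain ⟨j, rfl⟩ : ∃ j, m = k + j := ⟨m - k, by have := Finset.mem_range.1 hk; omega⟩
  have h1 : (intBinom (3 * ((k + j + 1 : ℕ) : ℤ) - k) (((k + j + 1 : ℕ) : ℤ) - 1 - k) : ℚ) =
      PowerSeries.coeff j B := by
    rw [hB, coeff_mk_one_pow, Nat.choose_symm_add,
      show 3 * ((k + j + 1 : ℕ) : ℤ) - k = (2 * (k + j + 1) + 1 + j : ℕ) by push_cast; ring,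
      show ((k + j + 1 : ℕ) : ℤ) - 1 - k = (j : ℕ) by push_cast; ring, intBinom_natCast]
    rfl
  have h2 : (intBinom (3 * ((k + j + 1 : ℕ) : ℤ) - 1 - k) (((k + j + 1 : ℕ) : ℤ) - 2 - k) : ℚ) =
      PowerSeries.coeff j (PowerSeries.X * B) := by
    rcases j with _ | j
    · rw [intBinom_of_neg (by push_cast; omega)]
      simp
    · rw [PowerSeries.coeff_succ_X_mul, hB, coeff_mk_one_pow, Nat.choose_symm_add,
        show 3 * ((k + (j + 1) + 1 : ℕ) : ℤ) - 1 - k =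
          (2 * (k + (j + 1) + 1) + 1 + j : ℕ) by push_cast; ring,
        show ((k + (j + 1) + 1 : ℕ) : ℤ) - 2 - k = (j : ℕ) by push_cast; ring, intBinom_natCast]
      rfl
  rw [Nat.add_sub_cancel_left, PowerSeries.coeff_mk, map_add, PowerSeries.coeff_C_mul, ← h1, ← h2]
  push_cast
  ring

theorem totalArea_two_mul (n : ℕ) :
    (totalArea (2 * n) : ℤ) = ∑ k ∈ Finset.range n, (3 : ℤ) ^ k *
      (intBinom (3 * n - k) (n - 1 - k) + 3 * intBinom (3 * n - 1 - k) (n - 2 - k)) := by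
  obtain ⟨t, h0, ht⟩ := existsUnique_mul_one_sub_sq_eq.exists
  have hA := areaGF_mul_eq h0 ht
  obtain ⟨r, hr⟩ : ∃ r, (1 - 3 * t) * r = 1 :=
    ⟨(1 - 3 * t)⁻¹, PowerSeries.mul_inv_cancel _ (by simp [h0])⟩
  have hsub : PowerSeries.HasSubst t := PowerSeries.HasSubst.of_constantCoeff_zero' h0
  obtain ⟨φ, hφ⟩ : ∃ φ : ℚ⟦X⟧ →ₐ[ℚ] ℚ⟦X⟧, φ PowerSeries.X = t :=
    ⟨PowerSeries.substAlgHom hsub, PowerSeries.substAlgHom_X hsub⟩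
  set K : ℚ⟦X⟧ := PowerSeries.mk 1 with hK
  set T : ℚ⟦X⟧ := PowerSeries.mk fun k => (3 : ℚ) ^ k with hT
  have hφK : φ K * (1 - t) = 1 := by
    have := congrArg φ (PowerSeries.mk_one_mul_one_sub_eq_one ℚ)
    simpa [hφ] using this
  have hT1 : T * (1 - 3 * PowerSeries.X) = 1 := by
    rw [show T * (1 - 3 * PowerSeries.X) = T - PowerSeries.X * (PowerSeries.C (3 : ℚ) * T) by
      rw [map_ofNat]; ring]
    ext n
    rcases n with _ | n
    · simp [hT]
    · rw [map_sub, PowerSeries.coeff_succ_X_mul, PowerSeries.coeff_C_mul, hT, PowerSeries.coeff_mk,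
        PowerSeries.coeff_mk, PowerSeries.coeff_one, if_neg n.succ_ne_zero]
      ring
  have hφT : φ T * (1 - 3 * t) = 1 := by
    have := congrArg φ hT1
    simpa only [map_mul, map_sub, map_one, map_ofNat, hφ] using this
  have hφTr : φ T = r := by linear_combination r * hφT - φ T * hr
  have key := coeff_algHom_mul_eq φ hφ h0 ht hr n
    (PowerSeries.X * (1 + 3 * PowerSeries.X) * T * K ^ 2)
  have hleft : φ (PowerSeries.X * (1 + 3 * PowerSeries.X) * T * K ^ 2) * ((1 - t) * r) =
      areaGF := by
    simp only [map_mul, map_add, map_pow, map_one, map_ofNat, hφ, hφTr]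
    have hr2 : (1 - 3 * t) ^ 2 * r ^ 2 = 1 := by rw [← mul_pow, hr, one_pow]
    linear_combination -(φ K) ^ 2 * r ^ 2 * (1 - t) * hA +
      areaGF * (φ K * (1 - t) + 1) * hφK + areaGF * (φ K * (1 - t)) ^ 2 * hr2
  rw [hleft, mul_assoc _ (K ^ 2), ← pow_add, add_comm 2, coeff_mul_mk_three_pow_mul_mk_one_pow,
    areaGF, PowerSeries.coeff_mk] at key
  exact_mod_cast key

theorem mainTheorem5 :
    -- the substitution `z ^ 2 = t * (1 - t) ^ 2` defines a unique power series `t` in `z`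
    -- without constant term
    (∃! t : ℚ⟦X⟧, PowerSeries.constantCoeff t = 0 ∧ t * (1 - t) ^ 2 = PowerSeries.X ^ 2) ∧
    IsFormalSum (fun i => (i : ℚ⟦X⟧) * deutschGF i * reversedDeutschGF i) areaGF ∧
    (∀ t : ℚ⟦X⟧, PowerSeries.constantCoeff t = 0 → t * (1 - t) ^ 2 = PowerSeries.X ^ 2 →
      areaGF = t * (1 + 3 * t) * ((1 - t) * (1 - 3 * t) ^ 2)⁻¹) ∧
    -- a sum in the discrete space `ℤ`, so all but finitely many terms vanish
    ∀ n : ℕ, HasSum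
      (fun k : ℕ => (3 : ℤ) ^ k *
        (intBinom (3 * n - k) (n - 1 - k) + 3 * intBinom (3 * n - 1 - k) (n - 2 - k)))
      (totalArea (2 * n) : ℤ) := by
  refine ⟨existsUnique_mul_one_sub_sq_eq, isFormalSum_areaGF, fun t h0 ht => ?_, fun n => ?_⟩
  · rw [PowerSeries.eq_mul_inv_iff_mul_eq (by simp [h0])]
    exact areaGF_mul_eq h0 ht
  · rw [totalArea_two_mul]
    refine hasSum_sum_of_ne_finset_zero fun k hk => ?_
    rw [Finset.mem_range, not_lt] at hk
    rw [intBinom_of_neg (by omega), intBinom_of_neg (by omega)]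
    simp
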